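/- Let $\mathcal H,\mathcal H_1,\dots,\mathcal H_n$ be finite-dimensional complex Hilbert spaces, let $N=\{1,\dots,n\}$, and for $X\subseteq N$ put $\mathcal H_X=\bigotimes_{i\in X}\mathcal H_i$. Let $\mathcal S(\mathcal J)$ be the set of density operators on a Hilbert space $\mathcal J$ and $\mathcal S_1(\mathcal J)$ the set of pure states on $\mathcal J$. A quantum operation is a completely positive and trace preserving map. A linear map $\mathcal E$ sending $\mathcal S(\mathcal J)$ into $\mathcal S(\mathcal K)$ is called reversible if there is a quantum operation $\mathcal R$ from $\mathcal S(\mathcal K)$ to $\mathcal S(\mathcal J)$ with $\mathcal R(\mathcal E(\rho))=\rho$ for all $\rho\in\mathcal S(\mathcal J)$, and vanishing if there is $\rho_0\in\mathcal S(\mathcal K)$ with $\mathcal E(\rho)=\rho_0$ for all $\rho\in\mathcal S(\mathcal J)$. A quantum secret sharing (QSS) scheme is a reversible quantum operation $W_N:\mathcal S(\mathcal H)\to\mathcal S(\mathcal H_N)$. For $X\subseteq N$ let $W_X=\mathrm{Tr}_{N\setminus X}\circ W_N$; the set $X$ is called qualified if $W_X$ is reversible, and forbidden if $W_X$ is vanishing.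 It is called significant if there is a forbidden set $Y\subseteq N$ such that $X\cup Y$ is qualified. Theorem. Let $W_N$ be any QSS scheme and let $X\subseteq N$ be significant. Then for every Borel probability measure $\mu$ on $\mathcal S_1(\mathcal H)$ with full support (that is, $\mu(O)>0$ for every nonempty relatively open set $O\subseteq\mathcal S_1(\mathcal H)$), $$H(\sigma_\mu)\le H(W_X(\sigma_\mu)),$$ where $\sigma_\mu=\int_{\mathcal S_1(\mathcal H)}\rho\,\mu(d\rho)$ and $H(\rho)=-\mathrm{Tr}\,\rho\log\rho$ is the von Neumann entropy. -/

import Mathlib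

open MeasureTheory
open scoped ComplexOrder

/-! Operators on a finite dimensional Hilbert space `ℂ^a` (`a` a finite type indexing an orthonormal
basis) are matrices in `Matrix a a ℂ`. The composite of shares with spaces `ℂ^(b i)`, `i ∈ X`, has
the product basis indexed by the dependent functions `∀ i : {i // i ∈ X}, b i`. -/

/-- The density operators on `ℂ^a`: positive semidefinite matrices of trace one. -/
def densityOperators (a : Type*) [Fintype a] : Set (Matrix a a ℂ) :=
  {ρ | ρ.PosSemidef ∧ ρ.trace = 1}

/-- The pure states on `ℂ^a`: the rank-one projections `|ψ⟩⟨ψ|` with `ψ` a unit vector. -/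
def pureStates (a : Type*) [Fintype a] : Set (Matrix a a ℂ) :=
  {ρ | ∃ ψ : a → ℂ, dotProduct (star ψ) ψ = 1 ∧ ρ = Matrix.vecMulVec ψ (star ψ)}

section QuantumOperation

open scoped CStarAlgebra Matrix.Norms.L2Operator MatrixOrder

/-- A quantum operation: a completely positive and trace preserving linear map. -/
structure QuantumOperation (a b : Type*) [Fintype a] [DecidableEq a] [Fintype b] [DecidableEq b]
    extends Matrix a a ℂ →CP Matrix b b ℂ where
  trace_map' : ∀ A : Matrix a a ℂ, (toLinearMap A).trace = A.trace

/-- The linear map on operators underlying a quantum operation. -/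
def QuantumOperation.lin {a b : Type*} [Fintype a] [DecidableEq a] [Fintype b] [DecidableEq b]
    (E : QuantumOperation a b) : Matrix a a ℂ →ₗ[ℂ] Matrix b b ℂ :=
  E.toLinearMap

end QuantumOperation

/-- `E` is reversible with respect to `S`: some quantum operation undoes `E` on `S`. -/
def IsReversibleOn {a b : Type*} [Fintype a] [DecidableEq a] [Fintype b] [DecidableEq b]
    (E : Matrix a a ℂ →ₗ[ℂ] Matrix b b ℂ) (S : Set (Matrix a a ℂ)) : Prop :=
  ∃ R : QuantumOperation b a, ∀ ρ ∈ S, R.lin (E ρ) = ρ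

/-- `E` is vanishing with respect to `S`: it maps all of `S` to one fixed density operator. -/
def IsVanishingOn {a b : Type*} [Fintype b]
    (E : Matrix a a ℂ →ₗ[ℂ] Matrix b b ℂ) (S : Set (Matrix a a ℂ)) : Prop :=
  ∃ ρ₀ ∈ densityOperators b, ∀ ρ ∈ S, E ρ = ρ₀

/-- The von Neumann entropy `H(ρ) = -Tr (ρ log ρ)`, with natural logarithm and `0 log 0 = 0`. -/
noncomputable def vonNeumannEntropy {a : Type*} [Fintype a] [DecidableEq a]
    (ρ : Matrix a a ℂ) : ℝ :=
  -((ρ * cfc Real.log ρ).trace).re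

/-- The average state `σ_μ = ∫ ρ dμ(ρ)` of an ensemble `μ` on a set `S` of states; the integral of
a matrix-valued function is taken entrywise. -/
noncomputable def averageState {a : Type*} {S : Set (Matrix a a ℂ)} [MeasurableSpace S]
    (μ : Measure S) : Matrix a a ℂ :=
  Matrix.of fun i j => ∫ ρ : S, (ρ : Matrix a a ℂ) i j ∂μ

section Shares

variable {ι : Type*} [Fintype ι] [DecidableEq ι]
  {b : ι → Type*} [∀ i, Fintype (b i)] [∀ i, DecidableEq (b i)]
  {a : Type*} [Fintype a] [DecidableEq a]

/-- The basis index of all shares assembled from an index `x` of the shares in `X` and an index `z`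
of the shares outside `X`. -/
def glueIndex (X : Finset ι) (x : ∀ i : {i // i ∈ X}, b i) (z : ∀ i : {i // i ∉ X}, b i) :
    ∀ i, b i :=
  fun i => if h : i ∈ X then x ⟨i, h⟩ else z ⟨i, h⟩

/-- The partial trace over the complement of `X`. -/
def partialTraceCompl (X : Finset ι) :
    Matrix (∀ i, b i) (∀ i, b i) ℂ →ₗ[ℂ]
      Matrix (∀ i : {i // i ∈ X}, b i) (∀ i : {i // i ∈ X}, b i) ℂ where
  toFun A := Matrix.of fun x y =>
    ∑ z : (∀ i : {i // i ∉ X}, b i), A (glueIndex X x z) (glueIndex X y z)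
  map_add' A B := by
    ext x y
    simp [Finset.sum_add_distrib]
  map_smul' c A := by
    ext x y
    simp [Finset.mul_sum]

/-- `W_X`: the encoder followed by the partial trace over the shares outside `X`. -/
def shareMap (W : QuantumOperation a (∀ i, b i)) (X : Finset ι) :
    Matrix a a ℂ →ₗ[ℂ] Matrix (∀ i : {i // i ∈ X}, b i) (∀ i : {i // i ∈ X}, b i) ℂ :=
  partialTraceCompl X ∘ₗ W.lin

/-- A quantum secret sharing scheme: an encoder that is reversible on all density operators. -/
def IsQSSScheme (W : QuantumOperation a (∀ i, b i)) : Prop :=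
  IsReversibleOn W.lin (densityOperators a)

/-- The set `X` of shares is qualified: the secret can be recovered from it. -/
def IsQualified (W : QuantumOperation a (∀ i, b i)) (X : Finset ι) : Prop :=
  IsReversibleOn (shareMap W X) (densityOperators a)

/-- The set `X` of shares is forbidden: its state does not depend on the secret. -/
def IsForbidden (W : QuantumOperation a (∀ i, b i)) (X : Finset ι) : Prop :=
  IsVanishingOn (shareMap W X) (densityOperators a)

/-- The set `X` of shares is significant: adding some forbidden set makes it qualified. -/
def IsSignificant (W : QuantumOperation a (∀ i, b i)) (X : Finset ι) : Prop :=
  ∃ Y : Finset ι, IsForbidden W Y ∧ IsQualified W (X ∪ Y)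

end Shares

/-!
Purify the secret by a reference system `R` and dilate the encoder by an environment, so that the
pure state lives on `R`, `X`, `Y` and `E`, where `E` consists of the environment and of all shares
outside `X ∪ Y`. The forbidden set `Y` is uncorrelated with `R`, and, since `X ∪ Y` is qualified, so
is `E`. Hence `S(R) + S(E) = S(RE) = S(XY) ≤ S(X) + S(Y)` by subadditivity, and likewise
`S(R) + S(Y) ≤ S(X) + S(E)` with the roles of `Y` and `E` exchanged. Adding the two inequalities
gives `S(R) ≤ S(X)`.
-/

section Spectral

open Matrix Polynomial
open scoped Kronecker

variable {m n : Type*} [Fintype m] [DecidableEq m] [Fintype n] [DecidableEq n]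

lemma exists_unitary_conj_eq_diagonal {A : Matrix n n ℂ} (hA : A.IsHermitian) :
    ∃ U ∈ unitaryGroup n ℂ, Uᴴ * A * U = diagonal fun i => (hA.eigenvalues i : ℂ) := by
  refine ⟨hA.eigenvectorUnitary, hA.eigenvectorUnitary.2, ?_⟩
  have h := hA.conjStarAlgAut_star_eigenvectorUnitary
  rwa [Unitary.conjStarAlgAut_star_apply] at h

lemma trace_cfc_eq_sum_eigenvalues {A : Matrix n n ℂ} (hA : A.IsHermitian) (f : ℝ → ℝ) :
    (cfc f A).trace = ∑ i, (f (hA.eigenvalues i) : ℂ) := by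
  rw [hA.cfc_eq, IsHermitian.cfc, Unitary.conjStarAlgAut_apply, trace_mul_cycle,
    Unitary.coe_star_mul_self, Matrix.one_mul, trace_diagonal]
  rfl

lemma vonNeumannEntropy_eq_sum_eigenvalues {A : Matrix n n ℂ} (hA : A.IsHermitian) :
    vonNeumannEntropy A = ∑ i, Real.negMulLog (hA.eigenvalues i) := by
  have hmul : A * cfc Real.log A = cfc (fun x => x * Real.log x) A := by
    rw [cfc_mul (fun x => x) Real.log A (A.finite_real_spectrum.continuousOn _)
      (A.finite_real_spectrum.continuousOn _), cfc_id' ℝ A hA.isSelfAdjoint]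
  rw [vonNeumannEntropy, hmul, trace_cfc_eq_sum_eigenvalues hA, ← Complex.ofReal_sum,
    Complex.ofReal_re, ← Finset.sum_neg_distrib]
  simp only [Real.negMulLog, neg_mul]

lemma vonNeumannEntropy_eq_sum_roots_charpoly {A : Matrix n n ℂ} (hA : A.IsHermitian) :
    vonNeumannEntropy A = (A.charpoly.roots.map fun z => Real.negMulLog z.re).sum := by
  rw [vonNeumannEntropy_eq_sum_eigenvalues hA, hA.roots_charpoly_eq_eigenvalues, Multiset.map_map]
  simp

lemma vonNeumannEntropy_transpose {A : Matrix n n ℂ} (hA : A.IsHermitian) :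
    vonNeumannEntropy Aᵀ = vonNeumannEntropy A := by
  rw [vonNeumannEntropy_eq_sum_roots_charpoly hA,
    vonNeumannEntropy_eq_sum_roots_charpoly hA.transpose, charpoly_transpose]

lemma vonNeumannEntropy_unitary_conj {A U : Matrix n n ℂ} (hA : A.IsHermitian)
    (hU : U ∈ unitaryGroup n ℂ) : vonNeumannEntropy (Uᴴ * A * U) = vonNeumannEntropy A := by
  have hU' : U * Uᴴ = 1 := mem_unitaryGroup_iff.1 hU
  rw [vonNeumannEntropy_eq_sum_roots_charpoly hA,
    vonNeumannEntropy_eq_sum_roots_charpoly (isHermitian_conjTranspose_mul_mul U hA),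
    Matrix.mul_assoc, charpoly_mul_comm, Matrix.mul_assoc, hU', Matrix.mul_one]

/- The characteristic polynomials of `M * Mᴴ` and `Mᴴ * M` agree up to powers of `X`, that is, up to
zero eigenvalues, and these do not contribute to the entropy. -/
lemma vonNeumannEntropy_mul_conjTranspose_self (M : Matrix m n ℂ) :
    vonNeumannEntropy (M * Mᴴ) = vonNeumannEntropy (Mᴴ * M) := by
  rw [vonNeumannEntropy_eq_sum_roots_charpoly (isHermitian_mul_conjTranspose_self M),
    vonNeumannEntropy_eq_sum_roots_charpoly (isHermitian_conjTranspose_mul_self M)]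
  have hne (k : ℕ) {p : ℂ[X]} (hp : p.Monic) : X ^ k * p ≠ 0 := ((monic_X_pow k).mul hp).ne_zero
  have h := congrArg (fun p : ℂ[X] => (p.roots.map fun z => Real.negMulLog z.re).sum)
    (charpoly_mul_comm' M Mᴴ)
  simpa [roots_mul (hne _ (charpoly_monic _)), Multiset.map_nsmul, Multiset.sum_nsmul] using h

lemma vonNeumannEntropy_diagonal (d : n → ℝ) :
    vonNeumannEntropy (diagonal fun i => (d i : ℂ)) = ∑ i, Real.negMulLog (d i) := by
  have hd : (diagonal fun i => (d i : ℂ)).IsHermitian :=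
    isHermitian_diagonal_iff.2 fun i => Complex.conj_ofReal (d i)
  rw [vonNeumannEntropy_eq_sum_roots_charpoly hd, charpoly_diagonal,
    roots_prod _ _ (Finset.prod_ne_zero_iff.2 fun i _ => X_sub_C_ne_zero _)]
  simp

lemma sum_eigenvalues_eq_re_trace {A : Matrix n n ℂ} (hA : A.IsHermitian) :
    ∑ i, hA.eigenvalues i = A.trace.re := by
  rw [hA.trace_eq_sum_eigenvalues, Complex.re_sum]
  rfl

lemma vonNeumannEntropy_kronecker {A : Matrix m m ℂ} {B : Matrix n n ℂ} (hA : A.IsHermitian)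
    (hB : B.IsHermitian) :
    vonNeumannEntropy (A ⊗ₖ B) =
      B.trace.re * vonNeumannEntropy A + A.trace.re * vonNeumannEntropy B := by
  obtain ⟨U, hU, hUA⟩ := exists_unitary_conj_eq_diagonal hA
  obtain ⟨V, hV, hVB⟩ := exists_unitary_conj_eq_diagonal hB
  have hdiag : (U ⊗ₖ V)ᴴ * (A ⊗ₖ B) * (U ⊗ₖ V) =
      diagonal fun i => ((hA.eigenvalues i.1 * hB.eigenvalues i.2 : ℝ) : ℂ) := by
    rw [conjTranspose_kronecker, ← mul_kronecker_mul, ← mul_kronecker_mul, hUA, hVB,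
      diagonal_kronecker_diagonal]
    simp only [Complex.ofReal_mul]
  have hAB : (A ⊗ₖ B).IsHermitian := by
    rw [IsHermitian, conjTranspose_kronecker, hA, hB]
  rw [← vonNeumannEntropy_unitary_conj hAB (kronecker_mem_unitary hU hV), hdiag,
    vonNeumannEntropy_diagonal, vonNeumannEntropy_eq_sum_eigenvalues hA,
    vonNeumannEntropy_eq_sum_eigenvalues hB, Fintype.sum_prod_type,
    ← sum_eigenvalues_eq_re_trace hA, ← sum_eigenvalues_eq_re_trace hB]
  simp only [Real.negMulLog_mul, Finset.sum_add_distrib, Finset.sum_mul_sum]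
  rw [Finset.sum_comm (γ := m)]

lemma sum_normSq_row_eq_one {U : Matrix n n ℂ} (hU : U ∈ unitaryGroup n ℂ) (i : n) :
    ∑ j, Complex.normSq (U i j) = 1 := by
  have h := congrFun (congrFun (mem_unitaryGroup_iff.1 hU) i) i
  simp only [mul_apply, star_apply, one_apply_eq, Complex.star_def, Complex.mul_conj] at h
  exact_mod_cast h

lemma re_diag_eq_sum_normSq_mul_eigenvalues {A : Matrix n n ℂ} (hA : A.IsHermitian) (i : n) :
    (A i i).re =
      ∑ j, Complex.normSq ((hA.eigenvectorUnitary : Matrix n n ℂ) i j) * hA.eigenvalues j := by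
  have h : A i i = ((∑ j, Complex.normSq ((hA.eigenvectorUnitary : Matrix n n ℂ) i j) *
      hA.eigenvalues j : ℝ) : ℂ) := by
    conv_lhs => rw [hA.spectral_theorem, Unitary.conjStarAlgAut_apply, mul_apply]
    push_cast
    refine Finset.sum_congr rfl fun j _ => ?_
    rw [mul_diagonal, star_apply, ← Complex.mul_conj, Complex.star_def]
    exact mul_right_comm _ _ _
  rw [h, Complex.ofReal_re]

/-- Peierls' inequality. -/
lemma sum_eigenvalues_le_sum_diag {A : Matrix n n ℂ} (hA : A.IsHermitian) {s : Set ℝ} {f : ℝ → ℝ}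
    (hf : ConcaveOn ℝ s f) (hs : ∀ i, hA.eigenvalues i ∈ s) :
    ∑ i, f (hA.eigenvalues i) ≤ ∑ i, f (A i i).re := by
  set U : Matrix n n ℂ := (hA.eigenvectorUnitary : Matrix n n ℂ)
  have hU : U ∈ unitaryGroup n ℂ := hA.eigenvectorUnitary.2
  have hcol (j : n) : ∑ i, Complex.normSq (U i j) = 1 := by
    simpa [Complex.normSq_conj] using sum_normSq_row_eq_one (Unitary.star_mem hU) j
  calc ∑ j, f (hA.eigenvalues j)
      = ∑ j, ∑ i, Complex.normSq (U i j) * f (hA.eigenvalues j) := by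
        simp only [← Finset.sum_mul, hcol, one_mul]
    _ = ∑ i, ∑ j, Complex.normSq (U i j) * f (hA.eigenvalues j) := Finset.sum_comm
    _ ≤ ∑ i, f (A i i).re := by
        refine Finset.sum_le_sum fun i _ => ?_
        rw [re_diag_eq_sum_normSq_mul_eigenvalues hA]
        exact hf.le_map_sum (fun j _ => Complex.normSq_nonneg _) (sum_normSq_row_eq_one hU i)
          fun j _ => hs j

lemma vonNeumannEntropy_le_sum_negMulLog_diag {A : Matrix n n ℂ} (hA : A.PosSemidef) :
    vonNeumannEntropy A ≤ ∑ i, Real.negMulLog (A i i).re := by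
  rw [vonNeumannEntropy_eq_sum_eigenvalues hA.isHermitian]
  exact sum_eigenvalues_le_sum_diag hA.isHermitian Real.concaveOn_negMulLog hA.eigenvalues_nonneg

end Spectral

section PartialTrace

open Matrix
open scoped Kronecker

variable {m n : Type*}

/-- The partial trace over the second factor of a bipartite system. -/
def partialTraceRight [Fintype n] : Matrix (m × n) (m × n) ℂ →ₗ[ℂ] Matrix m m ℂ where
  toFun A := of fun i j => ∑ k, A (i, k) (j, k)
  map_add' A B := by
    ext i j
    simp [Finset.sum_add_distrib]
  map_smul' c A := by
    ext i j
    simp [Finset.mul_sum]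

/-- The partial trace over the first factor of a bipartite system. -/
def partialTraceLeft [Fintype m] : Matrix (m × n) (m × n) ℂ →ₗ[ℂ] Matrix n n ℂ where
  toFun A := of fun i j => ∑ k, A (k, i) (k, j)
  map_add' A B := by
    ext i j
    simp [Finset.sum_add_distrib]
  map_smul' c A := by
    ext i j
    simp [Finset.mul_sum]

lemma partialTraceRight_apply [Fintype n] (A : Matrix (m × n) (m × n) ℂ) (i j : m) :
    partialTraceRight A i j = ∑ k, A (i, k) (j, k) := rfl

lemma partialTraceLeft_apply [Fintype m] (A : Matrix (m × n) (m × n) ℂ) (i j : n) :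
    partialTraceLeft A i j = ∑ k, A (k, i) (k, j) := rfl

lemma posSemidef_partialTraceRight [Fintype n] {A : Matrix (m × n) (m × n) ℂ}
    (hA : A.PosSemidef) : (partialTraceRight A).PosSemidef := by
  have h : partialTraceRight A = ∑ k, A.submatrix (·, k) (·, k) := by
    ext i j
    simp [partialTraceRight_apply, Matrix.sum_apply]
  rw [h]
  exact posSemidef_sum _ fun k _ => hA.submatrix _

lemma posSemidef_partialTraceLeft [Fintype m] {A : Matrix (m × n) (m × n) ℂ}
    (hA : A.PosSemidef) : (partialTraceLeft A).PosSemidef :=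
  posSemidef_partialTraceRight (hA.submatrix Prod.swap)

variable [Fintype m] [Fintype n]

lemma trace_partialTraceRight (A : Matrix (m × n) (m × n) ℂ) :
    (partialTraceRight A).trace = A.trace := by
  simp only [trace, diag_apply, partialTraceRight_apply, Fintype.sum_prod_type]

lemma trace_partialTraceRight_mul [DecidableEq n] (A : Matrix (m × n) (m × n) ℂ)
    (B : Matrix m m ℂ) : (partialTraceRight A * B).trace = (A * (B ⊗ₖ 1)).trace := by
  simp only [trace, diag_apply, mul_apply, partialTraceRight_apply, Fintype.sum_prod_type,
    kronecker_apply, one_apply, mul_ite, mul_one, mul_zero, Finset.sum_ite_eq', Finset.mem_univ,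
    if_true, Finset.sum_mul]
  exact Finset.sum_congr rfl fun i _ => Finset.sum_comm

lemma trace_partialTraceLeft_mul [DecidableEq m] (A : Matrix (m × n) (m × n) ℂ)
    (B : Matrix n n ℂ) : (partialTraceLeft A * B).trace = (A * (1 ⊗ₖ B)).trace := by
  simp only [trace, diag_apply, mul_apply, partialTraceLeft_apply, Fintype.sum_prod_type_right,
    kronecker_apply, one_apply, ite_mul, one_mul, zero_mul, mul_ite, mul_zero, Finset.sum_ite_eq',
    Finset.mem_univ, if_true, Finset.sum_mul]
  exact Finset.sum_congr rfl fun i _ => Finset.sum_comm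

lemma partialTraceRight_kronecker_conj [DecidableEq n] (P : Matrix m m ℂ) {Q : Matrix n n ℂ}
    (hQ : Q ∈ unitaryGroup n ℂ) (A : Matrix (m × n) (m × n) ℂ) :
    partialTraceRight ((P ⊗ₖ Q)ᴴ * A * (P ⊗ₖ Q)) = Pᴴ * partialTraceRight A * P := by
  refine ext_iff_trace_mul_right.2 fun B => ?_
  have hQ' : Q * Qᴴ = 1 := mem_unitaryGroup_iff.1 hQ
  calc (partialTraceRight ((P ⊗ₖ Q)ᴴ * A * (P ⊗ₖ Q)) * B).trace
      = (A * ((P ⊗ₖ Q) * (B ⊗ₖ 1) * (P ⊗ₖ Q)ᴴ)).trace := by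
        rw [trace_partialTraceRight_mul, Matrix.mul_assoc, Matrix.mul_assoc, trace_mul_comm]
        simp only [Matrix.mul_assoc]
    _ = (partialTraceRight A * (P * B * Pᴴ)).trace := by
        rw [trace_partialTraceRight_mul, conjTranspose_kronecker, ← mul_kronecker_mul,
          ← mul_kronecker_mul, Matrix.mul_one, hQ']
    _ = (Pᴴ * partialTraceRight A * P * B).trace := by
        rw [Matrix.mul_assoc Pᴴ, Matrix.mul_assoc Pᴴ, trace_mul_comm Pᴴ]
        simp only [Matrix.mul_assoc]

lemma partialTraceLeft_kronecker_conj [DecidableEq m] {P : Matrix m m ℂ} (hP : P ∈ unitaryGroup m ℂ)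
    (Q : Matrix n n ℂ) (A : Matrix (m × n) (m × n) ℂ) :
    partialTraceLeft ((P ⊗ₖ Q)ᴴ * A * (P ⊗ₖ Q)) = Qᴴ * partialTraceLeft A * Q := by
  refine ext_iff_trace_mul_right.2 fun B => ?_
  have hP' : P * Pᴴ = 1 := mem_unitaryGroup_iff.1 hP
  calc (partialTraceLeft ((P ⊗ₖ Q)ᴴ * A * (P ⊗ₖ Q)) * B).trace
      = (A * ((P ⊗ₖ Q) * (1 ⊗ₖ B) * (P ⊗ₖ Q)ᴴ)).trace := by
        rw [trace_partialTraceLeft_mul, Matrix.mul_assoc, Matrix.mul_assoc, trace_mul_comm]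
        simp only [Matrix.mul_assoc]
    _ = (partialTraceLeft A * (Q * B * Qᴴ)).trace := by
        rw [trace_partialTraceLeft_mul, conjTranspose_kronecker, ← mul_kronecker_mul,
          ← mul_kronecker_mul, Matrix.mul_one, hP']
    _ = (Qᴴ * partialTraceLeft A * Q * B).trace := by
        rw [Matrix.mul_assoc Qᴴ, Matrix.mul_assoc Qᴴ, trace_mul_comm Qᴴ]
        simp only [Matrix.mul_assoc]

end PartialTrace

section Subadditivity

open Matrix
open scoped Kronecker

lemma negMulLog_le_neg_mul_log_add_neg_mul_log {p q r : ℝ} (hp : 0 ≤ p) (hpq : p ≤ q)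
    (hpr : p ≤ r) :
    Real.negMulLog p ≤ -(p * Real.log q) + -(p * Real.log r) + (q * r - p) := by
  rcases hp.eq_or_lt with rfl | hp
  · simpa using mul_nonneg hpq hpr
  have hq : 0 < q := hp.trans_le hpq
  have hr : 0 < r := hp.trans_le hpr
  have hlog : Real.log q + Real.log r - Real.log p ≤ q * r / p - 1 := by
    rw [← Real.log_mul hq.ne' hr.ne', ← Real.log_div (mul_pos hq hr).ne' hp.ne']
    exact Real.log_le_sub_one_of_pos (by positivity)
  have hmul : p * (Real.log q + Real.log r - Real.log p) ≤ q * r - p := by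
    simpa [mul_sub, mul_div_cancel₀ _ hp.ne'] using mul_le_mul_of_nonneg_left hlog hp.le
  rw [Real.negMulLog]
  linarith

lemma sum_negMulLog_le_sum_marginals {m n : Type*} [Fintype m] [Fintype n] {p : m × n → ℝ}
    (hp : ∀ i, 0 ≤ p i) (hp1 : ∑ i, p i = 1) :
    ∑ i, Real.negMulLog (p i) ≤
      ∑ i, Real.negMulLog (∑ j, p (i, j)) + ∑ j, Real.negMulLog (∑ i, p (i, j)) := by
  set q : m → ℝ := fun i => ∑ j, p (i, j)
  set r : n → ℝ := fun j => ∑ i, p (i, j)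
  have hpq (i : m) (j : n) : p (i, j) ≤ q i :=
    Finset.single_le_sum (f := fun j => p (i, j)) (fun _ _ => hp _) (Finset.mem_univ j)
  have hpr (i : m) (j : n) : p (i, j) ≤ r j :=
    Finset.single_le_sum (f := fun i => p (i, j)) (fun _ _ => hp _) (Finset.mem_univ i)
  have hq1 : ∑ i, q i = 1 := by rw [← hp1, Fintype.sum_prod_type]
  have hr1 : ∑ j, r j = 1 := by rw [← hp1, Fintype.sum_prod_type_right]
  have hdiff : ∑ i, ∑ j, (q i * r j - p (i, j)) = 0 := by
    simp only [Finset.sum_sub_distrib, ← Finset.sum_mul_sum, hq1, hr1]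
    rw [← Fintype.sum_prod_type, hp1, one_mul, sub_self]
  calc ∑ i, Real.negMulLog (p i) = ∑ i, ∑ j, Real.negMulLog (p (i, j)) := Fintype.sum_prod_type _
    _ ≤ ∑ i, ∑ j, (-(p (i, j) * Real.log (q i)) + -(p (i, j) * Real.log (r j)) +
          (q i * r j - p (i, j))) :=
        Finset.sum_le_sum fun i _ => Finset.sum_le_sum fun j _ =>
          negMulLog_le_neg_mul_log_add_neg_mul_log (hp _) (hpq i j) (hpr i j)
    _ = ∑ i, ∑ j, -(p (i, j) * Real.log (q i)) + ∑ j, ∑ i, -(p (i, j) * Real.log (r j)) := by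
        simp only [Finset.sum_add_distrib, hdiff, add_zero]
        rw [add_right_inj]
        exact Finset.sum_comm
    _ = ∑ i, Real.negMulLog (q i) + ∑ j, Real.negMulLog (r j) := by
        simp only [Finset.sum_neg_distrib, ← Finset.sum_mul, Real.negMulLog, neg_mul, q, r]

variable {m n : Type*} [Fintype m] [DecidableEq m] [Fintype n] [DecidableEq n]

/- Conjugating by a product unitary that diagonalizes both marginals reduces the inequality to the
subadditivity of the Shannon entropy of the diagonal. -/
theorem vonNeumannEntropy_le_add_partialTrace {ρ : Matrix (m × n) (m × n) ℂ}
    (hρ : ρ ∈ densityOperators (m × n)) :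
    vonNeumannEntropy ρ ≤
      vonNeumannEntropy (partialTraceRight ρ) + vonNeumannEntropy (partialTraceLeft ρ) := by
  have hm := (posSemidef_partialTraceRight hρ.1).isHermitian
  have hn := (posSemidef_partialTraceLeft hρ.1).isHermitian
  obtain ⟨U, hU, hUm⟩ := exists_unitary_conj_eq_diagonal hm
  obtain ⟨V, hV, hVn⟩ := exists_unitary_conj_eq_diagonal hn
  have hUV : U ⊗ₖ V ∈ unitaryGroup (m × n) ℂ := kronecker_mem_unitary hU hV
  have hUV' : (U ⊗ₖ V) * (U ⊗ₖ V)ᴴ = 1 := mem_unitaryGroup_iff.1 hUV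
  set τ := (U ⊗ₖ V)ᴴ * ρ * (U ⊗ₖ V)
  have hτ : τ.PosSemidef := hρ.1.conjTranspose_mul_mul_same _
  have hτ1 : τ.trace = 1 := by rw [trace_mul_cycle, hUV', Matrix.one_mul, hρ.2]
  have hτm (i : m) : ∑ j, (τ (i, j) (i, j)).re = hm.eigenvalues i := by
    have h := congrFun (congrFun ((partialTraceRight_kronecker_conj U hV ρ).trans hUm) i) i
    simpa [partialTraceRight_apply] using congrArg Complex.re h
  have hτn (j : n) : ∑ i, (τ (i, j) (i, j)).re = hn.eigenvalues j := by
    have h := congrFun (congrFun ((partialTraceLeft_kronecker_conj hU V ρ).trans hVn) j) j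
    simpa [partialTraceLeft_apply] using congrArg Complex.re h
  calc vonNeumannEntropy ρ = vonNeumannEntropy τ :=
        (vonNeumannEntropy_unitary_conj hρ.1.isHermitian hUV).symm
    _ ≤ ∑ i, Real.negMulLog (τ i i).re := vonNeumannEntropy_le_sum_negMulLog_diag hτ
    _ ≤ ∑ i, Real.negMulLog (∑ j, (τ (i, j) (i, j)).re) +
          ∑ j, Real.negMulLog (∑ i, (τ (i, j) (i, j)).re) :=
        sum_negMulLog_le_sum_marginals (fun i => (Complex.le_def.1 hτ.diag_nonneg).1)
          (by simpa [trace] using congrArg Complex.re hτ1)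
    _ = vonNeumannEntropy (partialTraceRight ρ) + vonNeumannEntropy (partialTraceLeft ρ) := by
        simp only [hτm, hτn, vonNeumannEntropy_eq_sum_eigenvalues hm,
          vonNeumannEntropy_eq_sum_eigenvalues hn]

end Subadditivity

section Kraus

open Matrix

variable {a m κ : Type*} [Fintype a]

/-- The completely positive map with Kraus operators `K`. -/
def krausMap [Fintype κ] (K : κ → Matrix m a ℂ) : Matrix a a ℂ →ₗ[ℂ] Matrix m m ℂ where
  toFun ρ := ∑ k, K k * ρ * (K k)ᴴ
  map_add' ρ σ := by simp only [Matrix.mul_add, Matrix.add_mul, Finset.sum_add_distrib]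
  map_smul' c ρ := by
    simp only [Matrix.mul_smul, Matrix.smul_mul, Finset.smul_sum, RingHom.id_apply]

/-- The Kraus operators of the complementary channel of `krausMap T`, which maps the input to the
state of the environment `κ` of the dilation `L p (s, e) = T e p s`. -/
def complementaryKraus (T : κ → Matrix m a ℂ) : m → Matrix κ a ℂ :=
  fun p => of fun e s => T e p s

lemma krausMap_apply [Fintype κ] (K : κ → Matrix m a ℂ) (ρ : Matrix a a ℂ) :
    krausMap K ρ = ∑ k, K k * ρ * (K k)ᴴ := rfl

lemma krausMap_apply_apply [Fintype κ] (K : κ → Matrix m a ℂ) (ρ : Matrix a a ℂ) (p q : m) :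
    krausMap K ρ p q = ∑ k, ∑ j, ∑ i, K k p i * ρ i j * star (K k q j) := by
  simp only [krausMap_apply, Matrix.sum_apply, mul_apply, conjTranspose_apply, Finset.sum_mul]

lemma krausMap_single_apply [DecidableEq a] [Fintype κ] (K : κ → Matrix m a ℂ) (i j : a)
    (p q : m) : krausMap K (single i j 1) p q = ∑ k, K k p i * star (K k q j) := by
  simp [krausMap_apply_apply, single_apply, ite_and]

lemma posSemidef_krausMap [Fintype κ] [Finite m] (K : κ → Matrix m a ℂ) {ρ : Matrix a a ℂ}
    (hρ : ρ.PosSemidef) : (krausMap K ρ).PosSemidef :=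
  posSemidef_sum _ fun k _ => hρ.mul_mul_conjTranspose_same (K k)

lemma krausMap_submatrix [Fintype κ] {n : Type*} (K : κ → Matrix m a ℂ) (u : n → m)
    (ρ : Matrix a a ℂ) :
    krausMap (fun k => (K k).submatrix u id) ρ = (krausMap K ρ).submatrix u u := by
  ext p q
  simp only [krausMap_apply_apply, submatrix_apply, id_eq]

lemma krausMap_comp_equiv [Fintype κ] {κ' : Type*} [Fintype κ'] (K : κ → Matrix m a ℂ)
    (u : κ' ≃ κ) : krausMap (K ∘ u) = krausMap K :=
  LinearMap.ext fun ρ => u.sum_comp fun k => K k * ρ * (K k)ᴴ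

lemma krausMap_complementaryKraus_apply [Fintype m] (T : κ → Matrix m a ℂ) (ρ : Matrix a a ℂ)
    (e f : κ) : krausMap (complementaryKraus T) ρ e f = (T e * ρ * (T f)ᴴ).trace := by
  simp only [krausMap_apply_apply, complementaryKraus, of_apply, trace, diag_apply, mul_apply,
    conjTranspose_apply, Finset.sum_mul]

lemma trace_krausMap_complementaryKraus [Fintype m] [Fintype κ] (T : κ → Matrix m a ℂ)
    (ρ : Matrix a a ℂ) : (krausMap (complementaryKraus T) ρ).trace = (krausMap T ρ).trace := by
  rw [krausMap_apply T, trace_sum]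
  exact Finset.sum_congr rfl fun e _ => krausMap_complementaryKraus_apply T ρ e e

end Kraus

section Choi

open Matrix
open scoped CStarAlgebra Matrix.Norms.L2Operator MatrixOrder

variable {a b : Type*} [Fintype a] [Fintype b]

lemma exists_eq_star_mul_self_of_nonneg {A : Type*} [NonUnitalCStarAlgebra A] [PartialOrder A]
    [StarOrderedRing A] {x : A} (hx : 0 ≤ x) : ∃ y, x = star y * y :=
  CStarAlgebra.nonneg_iff_eq_star_mul_self.1 hx

lemma exists_eq_mul_conjTranspose_self {A : Matrix a a ℂ} (hA : A.PosSemidef) :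
    ∃ B : Matrix a a ℂ, A = B * Bᴴ := by
  classical
  obtain ⟨C, hC⟩ := exists_eq_star_mul_self_of_nonneg (Matrix.nonneg_iff_posSemidef.2 hA)
  exact ⟨Cᴴ, by rw [conjTranspose_conjTranspose]; exact hC⟩

lemma linearMap_eq_of_eqOn_densityOperators {M : Type*} [AddCommGroup M] [Module ℂ M]
    {L L' : Matrix a a ℂ →ₗ[ℂ] M} (h : Set.EqOn L L' (densityOperators a)) : L = L' := by
  classical
  refine LinearMap.ext_on (CStarAlgebra.span_nonneg (A := Matrix a a ℂ)) fun A hA => ?_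
  have hA' : A.PosSemidef := Matrix.nonneg_iff_posSemidef.1 hA
  rcases eq_or_ne A.trace 0 with h0 | h0
  · rw [hA'.trace_eq_zero_iff.1 h0, map_zero, map_zero]
  · have hρ : A.trace⁻¹ • A ∈ densityOperators a :=
      ⟨hA'.smul (inv_nonneg.2 hA'.trace_nonneg), by simp [h0]⟩
    simpa [h0] using h hρ

variable [DecidableEq a] [DecidableEq b]

/-- The Choi matrix of the identity channel, with blocks `|i⟩⟨j|`. Its image under a completely
positive map determines that map. -/
def choiMatrix (a : Type*) [Fintype a] [DecidableEq a] : CStarMatrix a a (Matrix a a ℂ) :=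
  CStarMatrix.ofMatrix fun i j => single i j 1

lemma choiMatrix_nonneg : 0 ≤ choiMatrix a := by
  rcases isEmpty_or_nonempty a with ha | ⟨⟨i₀⟩⟩
  · exact (Subsingleton.elim _ _ : (0 : CStarMatrix a a (Matrix a a ℂ)) = choiMatrix a).le
  have hΩ (i j : a) : choiMatrix a i j = single i j 1 := rfl
  let B : CStarMatrix a a (Matrix a a ℂ) :=
    CStarMatrix.ofMatrix fun k j => if k = i₀ then single i₀ j 1 else 0
  have hB (k j : a) : B k j = if k = i₀ then single i₀ j 1 else 0 := rfl
  have h : choiMatrix a = star B * B := by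
    refine CStarMatrix.ext fun i j => ?_
    rw [CStarMatrix.mul_apply, Fintype.sum_eq_single i₀ fun k hk => by simp [hB, hk]]
    simp [hB, hΩ, CStarMatrix.star_apply, star_eq_conjTranspose]
  exact h ▸ star_mul_self_nonneg B

/- The Kraus operators are the rows of a square root of the image of the Choi matrix. -/
theorem QuantumOperation.exists_lin_eq_krausMap (E : QuantumOperation a b) :
    ∃ K : a × b → Matrix b a ℂ, E.lin = krausMap K := by
  obtain ⟨C, hC⟩ := exists_eq_star_mul_self_of_nonneg
    (E.toCompletelyPositiveMap.map_cstarMatrix_nonneg _ choiMatrix_nonneg)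
  refine ⟨fun k => of fun p i => star (C k.1 i k.2 p),
    Matrix.ext_linearMap _ fun i j => LinearMap.ext_ring ?_⟩
  have hblock : E.lin (single i j 1) = ∑ k, star (C k i) * C k j :=
    (congrFun (congrFun hC i) j).trans CStarMatrix.mul_apply
  ext p q
  rw [LinearMap.comp_apply, LinearMap.comp_apply, singleLinearMap_apply, krausMap_single_apply,
    hblock, Fintype.sum_prod_type, Matrix.sum_apply]
  simp [mul_apply, star_eq_conjTranspose]

lemma QuantumOperation.trace_lin (E : QuantumOperation a b) (A : Matrix a a ℂ) :
    (E.lin A).trace = A.trace := E.trace_map' A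

end Choi

section Complementary

open Matrix
open scoped Kronecker

variable {a m κ : Type*} [Fintype a] [Fintype m]

lemma IsVanishingOn.exists_eq_trace_smul {E : Matrix a a ℂ →ₗ[ℂ] Matrix m m ℂ}
    (hE : IsVanishingOn E (densityOperators a)) :
    ∃ ρ₀ ∈ densityOperators m, ∀ A, E A = A.trace • ρ₀ := by
  obtain ⟨ρ₀, hρ₀, hE⟩ := hE
  refine ⟨ρ₀, hρ₀, LinearMap.congr_fun (f := E) (g := (traceLinearMap a ℂ ℂ).smulRight ρ₀)
    (linearMap_eq_of_eqOn_densityOperators fun ρ hρ => ?_)⟩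
  simp [hE ρ hρ, hρ.2]

/-- The Knill–Laflamme condition. -/
lemma conjTranspose_mul_eq_smul_one [DecidableEq a] {T : κ → Matrix m a ℂ} {γ : Matrix κ κ ℂ}
    (hγ : ∀ A, krausMap (complementaryKraus T) A = A.trace • γ) (e f : κ) :
    (T e)ᴴ * T f = γ f e • 1 := by
  refine ext_iff_trace_mul_left.2 fun A => ?_
  calc (A * ((T e)ᴴ * T f)).trace = krausMap (complementaryKraus T) A f e := by
        rw [krausMap_complementaryKraus_apply, ← Matrix.mul_assoc, trace_mul_cycle]
    _ = (A * (γ f e • 1)).trace := by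
        rw [hγ, Matrix.smul_apply, Matrix.mul_smul, Matrix.mul_one, trace_smul, smul_eq_mul,
          smul_eq_mul, mul_comm]

variable [Fintype κ]

lemma krausMap_comp {n κ' : Type*} [Fintype κ'] (S : κ' → Matrix n m ℂ) (T : κ → Matrix m a ℂ) :
    krausMap S ∘ₗ krausMap T = krausMap fun k : κ' × κ => S k.1 * T k.2 := by
  ext1 ρ
  simp only [LinearMap.comp_apply, krausMap_apply, Matrix.mul_sum, Matrix.sum_mul,
    conjTranspose_mul, Matrix.mul_assoc, Fintype.sum_prod_type]

lemma exists_eq_smul_one_of_krausMap_eq_id [DecidableEq a] {A : κ → Matrix a a ℂ}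
    (hA : krausMap A = LinearMap.id) : ∃ c : κ → ℂ, ∀ k, A k = c k • 1 := by
  have h (i j p q : a) : ∑ k, A k p i * star (A k q j) = if i = p ∧ j = q then 1 else 0 := by
    rw [← krausMap_single_apply, hA, LinearMap.id_apply, single_apply]
  have hzero {f : κ → ℂ} (hf : ∑ k, f k * star (f k) = 0) (k : κ) : f k = 0 :=
    CStarRing.mul_star_self_eq_zero_iff _ |>.1 <|
      (Finset.sum_eq_zero_iff_of_nonneg fun k _ => mul_star_self_nonneg (f k)).1 hf k
        (Finset.mem_univ k)
  rcases isEmpty_or_nonempty a with ha | ⟨⟨i₀⟩⟩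
  · exact ⟨0, fun k => Subsingleton.elim _ _⟩
  refine ⟨fun k => A k i₀ i₀, fun k => ?_⟩
  ext i j
  rcases eq_or_ne i j with rfl | hij
  · have hdiag : A k i i - A k i₀ i₀ = 0 :=
      hzero (f := fun k => A k i i - A k i₀ i₀)
        (by simp only [star_sub, mul_sub, sub_mul, Finset.sum_sub_distrib, h]; simp) k
    simpa [sub_eq_zero] using hdiag
  · have hoff : A k i j = 0 := hzero (by rw [h, if_neg fun hji => hij hji.1.symm]) k
    simpa [hij] using hoff

/- Since `krausMap S` recovers the secret, every `S k * T e` is a scalar, and the state of the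
environment is computed by these scalars alone. -/
theorem isVanishingOn_complementaryKraus_of_isReversibleOn [DecidableEq a] [DecidableEq m]
    {T : κ → Matrix m a ℂ} (hne : (densityOperators a).Nonempty)
    (hT : IsReversibleOn (krausMap T) (densityOperators a)) :
    IsVanishingOn (krausMap (complementaryKraus T)) (densityOperators a) := by
  obtain ⟨R, hR⟩ := hT
  obtain ⟨S, hS⟩ := R.exists_lin_eq_krausMap
  have hid : krausMap S ∘ₗ krausMap T = LinearMap.id :=
    linearMap_eq_of_eqOn_densityOperators fun ρ hρ => by
      rw [← hS, LinearMap.comp_apply, hR ρ hρ, LinearMap.id_apply]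
  obtain ⟨c, hc⟩ := exists_eq_smul_one_of_krausMap_eq_id ((krausMap_comp S T).symm.trans hid)
  have hscalar (ρ : Matrix a a ℂ) (e f : κ) : krausMap (complementaryKraus T) ρ e f =
      (∑ k, c (k, e) * star (c (k, f))) * ρ.trace := by
    calc krausMap (complementaryKraus T) ρ e f
        = (krausMap S (T e * ρ * (T f)ᴴ)).trace := by
          rw [krausMap_complementaryKraus_apply, ← hS, R.trace_lin]
      _ = ∑ k, ((S k * T e) * ρ * (S k * T f)ᴴ).trace := by
          simp only [krausMap_apply, trace_sum, conjTranspose_mul, Matrix.mul_assoc]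
      _ = (∑ k, c (k, e) * star (c (k, f))) * ρ.trace := by
          simp only [fun k e => hc (k, e), conjTranspose_smul, conjTranspose_one, Matrix.smul_mul,
            Matrix.mul_smul, Matrix.one_mul, Matrix.mul_one, trace_smul, smul_eq_mul,
            Finset.sum_mul, mul_assoc, mul_left_comm]
  obtain ⟨ρ₁, hρ₁⟩ := hne
  refine ⟨krausMap (complementaryKraus T) ρ₁, ⟨posSemidef_krausMap _ hρ₁.1, ?_⟩, fun ρ hρ => ?_⟩
  · rw [trace_krausMap_complementaryKraus, ← R.trace_lin, hR ρ₁ hρ₁, hρ₁.2]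
  · ext e f
    rw [hscalar, hscalar, hρ.2, hρ₁.2]

/- For `ρ = B * Bᴴ` let `M` be the dilation of `T` applied to `B`. Then `M * Mᴴ` is the output, and
by the Knill–Laflamme condition `Mᴴ * M = (Bᴴ * B) ⊗ₖ γᵀ`, where `γ` is the state of the
environment. -/
theorem vonNeumannEntropy_krausMap_of_isVanishingOn [DecidableEq a] [DecidableEq m]
    [DecidableEq κ] {T : κ → Matrix m a ℂ}
    (hT : IsVanishingOn (krausMap (complementaryKraus T)) (densityOperators a))
    {ρ : Matrix a a ℂ} (hρ : ρ ∈ densityOperators a) :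
    vonNeumannEntropy (krausMap T ρ) =
      vonNeumannEntropy ρ + vonNeumannEntropy (krausMap (complementaryKraus T) ρ) := by
  obtain ⟨γ, hγ, hTγ⟩ := hT.exists_eq_trace_smul
  obtain ⟨B, rfl⟩ := exists_eq_mul_conjTranspose_self hρ.1
  let M : Matrix m (a × κ) ℂ := of fun p se => (T se.2 * B) p se.1
  have hout : M * Mᴴ = krausMap T (B * Bᴴ) := by
    ext p q
    have hassoc (e : κ) : T e * (B * Bᴴ) * (T e)ᴴ = (T e * B) * (T e * B)ᴴ := by
      simp only [conjTranspose_mul, Matrix.mul_assoc]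
    simp only [krausMap_apply, hassoc, Matrix.sum_apply]
    exact Fintype.sum_prod_type_right _
  have hin : Mᴴ * M = (Bᴴ * B) ⊗ₖ γᵀ := by
    ext ⟨s, e⟩ ⟨t, f⟩
    have hassoc : (T e * B)ᴴ * (T f * B) = γ f e • (Bᴴ * B) := by
      rw [conjTranspose_mul, Matrix.mul_assoc, ← Matrix.mul_assoc (T e)ᴴ,
        conjTranspose_mul_eq_smul_one hTγ, Matrix.smul_mul, Matrix.one_mul, Matrix.mul_smul]
    exact (congrFun (congrFun hassoc s) t).trans (mul_comm _ _)
  have htrace : (Bᴴ * B).trace = 1 := by rw [trace_mul_comm, hρ.2]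
  rw [← hout, vonNeumannEntropy_mul_conjTranspose_self, hin,
    vonNeumannEntropy_kronecker (isHermitian_conjTranspose_mul_self B)
      hγ.1.isHermitian.transpose, trace_transpose, hγ.2, htrace, Complex.one_re, one_mul, one_mul,
    vonNeumannEntropy_transpose hγ.1.isHermitian, ← vonNeumannEntropy_mul_conjTranspose_self,
    hTγ, hρ.2, one_smul]

end Complementary

section Exchange

open Matrix

variable {a x y e : Type*}

/-- The Kraus operators obtained from those of a channel with output `x × y` and environment `e` by
exchanging the roles of `y` and `e`. -/
def exchangeKraus (T : e → Matrix (x × y) a ℂ) : y → Matrix (x × e) a ℂ :=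
  fun k => of fun p s => T p.2 (p.1, k) s

variable [Fintype a]

lemma partialTraceRight_krausMap_exchangeKraus [Fintype y] [Fintype e]
    (T : e → Matrix (x × y) a ℂ) (ρ : Matrix a a ℂ) :
    partialTraceRight (krausMap (exchangeKraus T) ρ) = partialTraceRight (krausMap T ρ) := by
  ext p q
  simp only [partialTraceRight_apply, krausMap_apply_apply]
  exact Finset.sum_comm

lemma krausMap_complementaryKraus_exchangeKraus [Fintype x] [Fintype e]
    (T : e → Matrix (x × y) a ℂ) :
    krausMap (complementaryKraus (exchangeKraus T)) = partialTraceLeft ∘ₗ krausMap T := by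
  ext ρ p q
  simp only [LinearMap.comp_apply, partialTraceLeft_apply, krausMap_apply_apply,
    Fintype.sum_prod_type]
  rfl

variable [DecidableEq a] [Fintype x] [DecidableEq x] [Fintype y] [Fintype e]

lemma vonNeumannEntropy_add_complementaryKraus_le [DecidableEq y] [DecidableEq e]
    {T : e → Matrix (x × y) a ℂ}
    (hT : IsVanishingOn (krausMap (complementaryKraus T)) (densityOperators a))
    {ρ : Matrix a a ℂ} (hρ : ρ ∈ densityOperators a) :
    vonNeumannEntropy ρ + vonNeumannEntropy (krausMap (complementaryKraus T) ρ) ≤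
      vonNeumannEntropy (partialTraceRight (krausMap T ρ)) +
        vonNeumannEntropy (partialTraceLeft (krausMap T ρ)) := by
  obtain ⟨γ, hγ, hTγ⟩ := hT
  have hout : krausMap T ρ ∈ densityOperators (x × y) :=
    ⟨posSemidef_krausMap T hρ.1, by rw [← trace_krausMap_complementaryKraus, hTγ ρ hρ, hγ.2]⟩
  rw [← vonNeumannEntropy_krausMap_of_isVanishingOn ⟨γ, hγ, hTγ⟩ hρ]
  exact vonNeumannEntropy_le_add_partialTrace hout

theorem vonNeumannEntropy_le_partialTraceRight_krausMap {T : e → Matrix (x × y) a ℂ}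
    (he : IsVanishingOn (krausMap (complementaryKraus T)) (densityOperators a))
    (hy : IsVanishingOn (partialTraceLeft ∘ₗ krausMap T) (densityOperators a))
    {ρ : Matrix a a ℂ} (hρ : ρ ∈ densityOperators a) :
    vonNeumannEntropy ρ ≤ vonNeumannEntropy (partialTraceRight (krausMap T ρ)) := by
  classical
  rw [← krausMap_complementaryKraus_exchangeKraus] at hy
  have hxy := vonNeumannEntropy_add_complementaryKraus_le he hρ
  have hxe := vonNeumannEntropy_add_complementaryKraus_le hy hρ
  have hexch : partialTraceLeft (krausMap (exchangeKraus T) ρ) =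
      krausMap (complementaryKraus T) ρ :=
    (LinearMap.congr_fun (krausMap_complementaryKraus_exchangeKraus (exchangeKraus T)) ρ).symm
  rw [partialTraceRight_krausMap_exchangeKraus, hexch,
    krausMap_complementaryKraus_exchangeKraus, LinearMap.comp_apply] at hxe
  linarith

end Exchange

section Average

open Matrix

variable {a : Type*} [Fintype a]

lemma pureStates_subset_densityOperators : pureStates a ⊆ densityOperators a := by
  rintro _ ⟨ψ, hψ, rfl⟩
  exact ⟨posSemidef_vecMulVec_self_star ψ, by rw [trace_vecMulVec, dotProduct_comm, hψ]⟩

lemma convex_densityOperators : Convex ℝ (densityOperators a) := by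
  intro ρ hρ σ hσ s t hs ht hst
  refine ⟨(hρ.1.smul hs).add (hσ.1.smul ht), ?_⟩
  rw [trace_add, trace_smul, trace_smul, hρ.2, hσ.2, ← add_smul, hst, one_smul]

lemma isClosed_densityOperators : IsClosed (densityOperators a) := by
  simp only [densityOperators, posSemidef_iff_dotProduct_mulVec, IsHermitian, Set.ofPred_and,
    Set.ofPred_forall]
  refine ((isClosed_eq (by fun_prop) continuous_id).inter (isClosed_iInter fun x => ?_)).inter
    (isClosed_eq (by fun_prop) continuous_const)
  exact isClosed_le continuous_const (by fun_prop)

open scoped Matrix.Norms.L2Operator MatrixOrder in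
lemma norm_le_one_of_mem_densityOperators [DecidableEq a] {ρ : Matrix a a ℂ}
    (hρ : ρ ∈ densityOperators a) : ‖ρ‖ ≤ 1 := by
  have hle (i : a) : hρ.1.isHermitian.eigenvalues i ≤ 1 :=
    calc hρ.1.isHermitian.eigenvalues i ≤ ∑ j, hρ.1.isHermitian.eigenvalues j :=
          Finset.single_le_sum (fun j _ => hρ.1.eigenvalues_nonneg j) (Finset.mem_univ i)
      _ = 1 := by rw [sum_eigenvalues_eq_re_trace, hρ.2, Complex.one_re]
  rw [CStarAlgebra.norm_le_one_iff_of_nonneg ρ (nonneg_iff_posSemidef.2 hρ.1)]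
  refine CFC.le_one (R := ℝ) ?_ hρ.1.isHermitian.isSelfAdjoint
  rw [hρ.1.isHermitian.spectrum_real_eq_range_eigenvalues]
  rintro _ ⟨i, rfl⟩
  exact hle i

open scoped Matrix.Norms.L2Operator in
lemma averageState_mem_densityOperators {S : Set (Matrix a a ℂ)} (hS : S ⊆ densityOperators a)
    [MeasurableSpace S] [BorelSpace S] (μ : Measure S) [IsProbabilityMeasure μ] :
    averageState μ ∈ densityOperators a := by
  classical
  have hint : Integrable (Subtype.val : S → Matrix a a ℂ) μ :=
    .of_bound continuous_subtype_val.stronglyMeasurable.aestronglyMeasurable 1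
      (.of_forall fun ρ => norm_le_one_of_mem_densityOperators (hS ρ.2))
  have haverage : averageState μ = ∫ ρ : S, (ρ : Matrix a a ℂ) ∂μ := by
    ext i j
    exact (entryLinearMap ℂ ℂ i j).toContinuousLinearMap.integral_comp_comm hint
  rw [haverage]
  exact convex_densityOperators.integral_mem isClosed_densityOperators
    (.of_forall fun ρ => hS ρ.2) hint

end Average

section ShareSplitting

open Matrix

/-- The splitting of a family indexed by a disjoint union `p` of two sets of shares `q` and `s` into
its parts over `q` and over `s`. -/
def piSubtypeSplit {ι : Type*} {p q s : ι → Prop} [DecidablePred q] (b : ι → Type*)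
    (hp : ∀ i, p i ↔ q i ∨ s i) (hqs : ∀ i, q i → ¬ s i) :
    (∀ i : {i // p i}, b i) ≃ (∀ i : {i // q i}, b i) × (∀ i : {i // s i}, b i) where
  toFun f := (fun i => f ⟨i, (hp i).2 (.inl i.2)⟩, fun i => f ⟨i, (hp i).2 (.inr i.2)⟩)
  invFun f i := if hq : q i then f.1 ⟨i, hq⟩ else f.2 ⟨i, ((hp i).1 i.2).resolve_left hq⟩
  left_inv f := by
    funext i
    by_cases hq : q i <;> simp [hq]
  right_inv f := by
    refine Prod.ext (funext fun i => ?_) (funext fun i => ?_)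
    · simp [i.2]
    · have hq : ¬ q i := fun hq => hqs i hq i.2
      simp [hq]

variable {ι : Type*} [Fintype ι] [DecidableEq ι] {b : ι → Type*} [∀ i, Fintype (b i)]
  {a : Type*} [Fintype a] {X Y Z : Finset ι}

lemma partialTraceRight_partialTraceCompl (hZ : ∀ i, i ∈ Z ↔ i ∈ X ∨ i ∈ Y)
    (hXY : ∀ i, i ∈ X → i ∉ Y) (A : Matrix (∀ i, b i) (∀ i, b i) ℂ) :
    partialTraceRight ((partialTraceCompl Z A).submatrix (piSubtypeSplit b hZ hXY).symm
      (piSubtypeSplit b hZ hXY).symm) = partialTraceCompl X A := by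
  have hXc (i : ι) : i ∉ X ↔ i ∈ Y ∨ i ∉ Z := by grind
  have hYZ (i : ι) (hi : i ∈ Y) : ¬ i ∉ Z := by grind
  have hglue x y z : glueIndex Z ((piSubtypeSplit b hZ hXY).symm (x, y)) z =
      glueIndex X x ((piSubtypeSplit b hXc hYZ).symm (y, z)) := by
    funext i
    by_cases hX : i ∈ X <;> by_cases hY : i ∈ Y <;> simp [glueIndex, piSubtypeSplit, hX, hY, hZ]
  ext x x'
  calc ∑ y, ∑ z, A (glueIndex Z ((piSubtypeSplit b hZ hXY).symm (x, y)) z)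
        (glueIndex Z ((piSubtypeSplit b hZ hXY).symm (x', y)) z)
      = ∑ w, A (glueIndex X x ((piSubtypeSplit b hXc hYZ).symm w))
          (glueIndex X x' ((piSubtypeSplit b hXc hYZ).symm w)) := by
        simp only [hglue, Fintype.sum_prod_type]
    _ = partialTraceCompl X A x x' :=
        (piSubtypeSplit b hXc hYZ).symm.sum_comp fun w => A (glueIndex X x w) (glueIndex X x' w)

lemma partialTraceLeft_partialTraceCompl (hZ : ∀ i, i ∈ Z ↔ i ∈ X ∨ i ∈ Y)
    (hXY : ∀ i, i ∈ X → i ∉ Y) (A : Matrix (∀ i, b i) (∀ i, b i) ℂ) :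
    partialTraceLeft ((partialTraceCompl Z A).submatrix (piSubtypeSplit b hZ hXY).symm
      (piSubtypeSplit b hZ hXY).symm) = partialTraceCompl Y A := by
  have hZ' (i : ι) : i ∈ Z ↔ i ∈ Y ∨ i ∈ X := (hZ i).trans or_comm
  have hYX (i : ι) (hi : i ∈ Y) : i ∉ X := fun hX => hXY i hX hi
  have hswap x y : (piSubtypeSplit b hZ hXY).symm (x, y) =
      (piSubtypeSplit b hZ' hYX).symm (y, x) :=
    (Equiv.symm_apply_eq _).2
      (congrArg Prod.swap ((piSubtypeSplit b hZ' hYX).apply_symm_apply (y, x)).symm)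
  rw [← partialTraceRight_partialTraceCompl hZ' hYX]
  ext y y'
  simp only [partialTraceLeft_apply, partialTraceRight_apply, submatrix_apply, hswap]

lemma partialTraceCompl_comp_krausMap {κ : Type*} [Fintype κ] (K : κ → Matrix (∀ i, b i) a ℂ)
    (X : Finset ι) :
    partialTraceCompl X ∘ₗ krausMap K = krausMap fun k : κ × ∀ i : {i // i ∉ X}, b i =>
      (K k.1).submatrix (glueIndex X · k.2) id := by
  ext1 ρ
  ext x y
  simp only [krausMap_apply_apply, Fintype.sum_prod_type_right]
  exact Finset.sum_congr rfl fun z _ => krausMap_apply_apply K ρ _ _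

end ShareSplitting

section SecretSharing

open Matrix

variable {ι : Type*} [Fintype ι] [DecidableEq ι]
  {b : ι → Type*} [∀ i, Fintype (b i)] [∀ i, DecidableEq (b i)]
  {a : Type*} [Fintype a] [DecidableEq a]
  {W : QuantumOperation a (∀ i, b i)} {X Y : Finset ι}

lemma IsForbidden.mono (hXY : X ⊆ Y) (hY : IsForbidden W Y) : IsForbidden W X := by
  obtain ⟨ρ₀, hρ₀, hW⟩ := hY
  have hZ (i : ι) : i ∈ Y ↔ i ∈ X ∨ i ∈ Y \ X := by grind
  have hd (i : ι) (hi : i ∈ X) : i ∉ Y \ X := by grind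
  let u := (piSubtypeSplit b hZ hd).symm
  refine ⟨partialTraceRight (ρ₀.submatrix u u),
    ⟨posSemidef_partialTraceRight (hρ₀.1.submatrix u), ?_⟩, fun ρ hρ => ?_⟩
  · rw [trace_partialTraceRight, ← hρ₀.2]
    exact u.sum_comp fun i => ρ₀ i i
  · rw [← hW ρ hρ]
    exact (partialTraceRight_partialTraceCompl hZ hd _).symm

theorem vonNeumannEntropy_le_shareMap_of_disjoint (hXY : Disjoint X Y) (hY : IsForbidden W Y)
    (hq : IsQualified W (X ∪ Y)) {ρ : Matrix a a ℂ} (hρ : ρ ∈ densityOperators a) :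
    vonNeumannEntropy ρ ≤ vonNeumannEntropy (shareMap W X ρ) := by
  obtain ⟨K, hK⟩ := W.exists_lin_eq_krausMap
  have hmem (i : ι) : i ∈ X ∪ Y ↔ i ∈ X ∨ i ∈ Y := Finset.mem_union
  have hd (i : ι) (hi : i ∈ X) : i ∉ Y := Finset.disjoint_left.1 hXY hi
  let u := (piSubtypeSplit b hmem hd).symm
  let T₀ (k : (a × ∀ i, b i) × ∀ i : {i // i ∉ X ∪ Y}, b i) :=
    (K k.1).submatrix (glueIndex (X ∪ Y) · k.2) id
  let T k := (T₀ k).submatrix u id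
  have hT₀ : shareMap W (X ∪ Y) = krausMap T₀ := by
    rw [shareMap, hK, partialTraceCompl_comp_krausMap]
  have hT (σ : Matrix a a ℂ) :
      krausMap T σ = (partialTraceCompl (X ∪ Y) (W.lin σ)).submatrix u u := by
    rw [krausMap_submatrix, ← hT₀]
    rfl
  have hright (σ : Matrix a a ℂ) : partialTraceRight (krausMap T σ) = shareMap W X σ := by
    rw [hT, partialTraceRight_partialTraceCompl hmem hd]
    rfl
  have hleft : partialTraceLeft ∘ₗ krausMap T = shareMap W Y := LinearMap.ext fun σ => by
    rw [LinearMap.comp_apply, hT, partialTraceLeft_partialTraceCompl hmem hd]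
    rfl
  have henv : krausMap (complementaryKraus T) = krausMap (complementaryKraus T₀) :=
    krausMap_comp_equiv (complementaryKraus T₀) u
  rw [IsQualified, hT₀] at hq
  rw [← hright]
  refine vonNeumannEntropy_le_partialTraceRight_krausMap ?_ (hleft ▸ hY) hρ
  rw [henv]
  exact isVanishingOn_complementaryKraus_of_isReversibleOn ⟨ρ, hρ⟩ hq

theorem theorem3_general (hX : IsSignificant W X) {ρ : Matrix a a ℂ}
    (hρ : ρ ∈ densityOperators a) :
    vonNeumannEntropy ρ ≤ vonNeumannEntropy (shareMap W X ρ) := by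
  obtain ⟨Y, hY, hXY⟩ := hX
  rw [← Finset.union_sdiff_self_eq_union] at hXY
  exact vonNeumannEntropy_le_shareMap_of_disjoint Finset.disjoint_sdiff
    (hY.mono Finset.sdiff_subset) hXY hρ

end SecretSharing

theorem theorem3 {ι : Type*} [Fintype ι] [DecidableEq ι]
    {a : Type*} [Fintype a] [DecidableEq a]
    {b : ι → Type*} [∀ i, Fintype (b i)] [∀ i, DecidableEq (b i)]
    (W : QuantumOperation a (∀ i, b i)) (hW : IsQSSScheme W)
    (X : Finset ι) (hX : IsSignificant W X)
    [MeasurableSpace (pureStates a)] [BorelSpace (pureStates a)]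
    (μ : Measure (pureStates a)) [IsProbabilityMeasure μ] [μ.IsOpenPosMeasure] :
    vonNeumannEntropy (averageState μ) ≤ vonNeumannEntropy (shareMap W X (averageState μ)) :=
  theorem3_general hX (averageState_mem_densityOperators pureStates_subset_densityOperators μ)
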